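/- **Setting.** Logarithms are base $2$ and $H(\mu)$ is the Shannon entropy in bits. Let $\mu$ be a distribution of $n$ files $\overline X=(X_1,\dots,X_n)$ over a finite alphabet $\Sigma$. A (cell-probe) *LDSC scheme* for $\mu$ with word size $w\ge 1$ encodes $\overline X$ as a finite sequence of $w$-bit cells (whose length may depend on $\overline X$) and has, for each $i$, a deterministic adaptive decoding algorithm that probes cells (a probe beyond the end returns a blank) and outputs $X_i$; decoding is correct for every $\overline X$ in the support of $\mu$. The scheme and its decoders may depend arbitrarily on $\mu$. Its decoding time is the maximum number of probes over all $i$ and all $\overline X$ in the support, and its space is the expected number of bits, $w$ times the expected number of cells. **(1) Independent distributions.** For all $C,\varepsilon>0$ there is $c=c(C,\varepsilon)>0$ such that the following holds. Let $\mu$ be a $k$-wise independent distribution on $\Sigma^n$ (any at most $k$ files are mutually independent) with each file uniform on $\Sigma$, whose degree of independence is proportional to its entropy measured in files: $H_\mu\le C\,k\lg|\Sigma|$. Suppose $w^{1+\varepsilon}\le H_\mu$ and $H_\mu^{1+\varepsilon}\le n$. Then every LDSC scheme for $\mu$ with space at most $C\cdot H_\mu$ bits has decoding time $$t\ \ge\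 c\,\lg H_\mu ,$$ and if moreover $H_\mu\ge n^{\varepsilon}$, then also $t\ge c\,\lg n$. **(2) Most low-entropy distributions.** For $f=(f_1,\dots,f_n)$ with $f_i:\{0,1\}^h\to\Sigma$, let $\mu_f$ be the law of $(f_1(Y),\dots,f_n(Y))$ for a uniformly random $Y\in\{0,1\}^h$. For every $\delta>0$ there is $h_0$ such that, for all $h\ge h_0$, all $n\ge 4h$, all finite $\Sigma$ with $|\Sigma|\ge2$ and all word sizes $w\geq 1$ with $\lg n\le h^{\delta/2}$ and $w\le h^{\delta/2}$, at least a $1-\delta$ fraction of all tuples $f$ satisfy: $H(\mu_f)=h$, and every LDSC scheme for $\mu_f$ has decoding time $t\ge h^{1-\delta}$ or uses more than $n^{1-\delta}$ bits of space. (For every fixed $\varepsilon\in(0,1)$ and $\delta>0$, this applies to $h=\lceil n^{\varepsilon}\rceil$ and $w=O(\lg n)$ once $n$ is large.) **(3) Tightness.** For all $n,h$, all $w\ge1$, all finite $\Sigma$ and every $f$ as in (2), there is an LDSC scheme for $\mu_f$ with space at most $h+w$ bits and decoding time at most $\lceil h/w\rceil$. -/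

import Mathlib

namespace LDSC

/-- Shannon entropy, in bits, of a distribution on a finite type. -/
noncomputable def entropy {α : Type*} [Fintype α] (μ : PMF α) : ℝ :=
  (∑ x, Real.negMulLog (μ x).toReal) / Real.log 2

/-- A memory cell of `w` bits. -/
abbrev Cell (w : ℕ) : Type := Fin w → Bool

/-- A memory state: a finite sequence of `w`-bit cells. -/
abbrev Memory (w : ℕ) : Type := List (Cell w)

/-- A deterministic adaptive cell-probe algorithm with outputs in `A`. It either stops with an
answer, or probes an address and continues according to the content of that cell. A probe beyond the
end of the memory returns `none`. Computation is free; only probes are counted. -/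
inductive ProbeAlg (w : ℕ) (A : Type*) where
  | answer (a : A) : ProbeAlg w A
  | probe (addr : ℕ) (next : Option (Cell w) → ProbeAlg w A) : ProbeAlg w A

/-- The output of a cell-probe algorithm on a memory state. -/
def ProbeAlg.output {w : ℕ} {A : Type*} (M : Memory w) : ProbeAlg w A → A
  | .answer a => a
  | .probe addr next => (next M[addr]?).output M

/-- The number of probes made by a cell-probe algorithm on a memory state. -/
def ProbeAlg.probes {w : ℕ} {A : Type*} (M : Memory w) : ProbeAlg w A → ℕ
  | .answer _ => 0
  | .probe addr next => (next M[addr]?).probes M + 1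

/-- A cell-probe data structure with word size `w` for `n` files over the alphabet `A`: an
encoder of the whole collection of files, and one decoding algorithm for each file. The number of
cells in use may depend on the files. -/
structure Scheme (n : ℕ) (A : Type*) (w : ℕ) where
  enc : (Fin n → A) → Memory w
  dec : Fin n → ProbeAlg w A

variable {n : ℕ} {A : Type*} {w : ℕ}

/-- The scheme solves the storage problem for `μ`: every file of every collection in the support
of `μ` is decoded correctly. -/
def Scheme.Solves (D : Scheme n A w) (μ : PMF (Fin n → A)) : Prop :=
  ∀ x ∈ μ.support, ∀ i, (D.dec i).output (D.enc x) = x i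

/-- The expected number of bits of memory used on a random collection of files. -/
noncomputable def Scheme.expectedBits [Fintype A] (D : Scheme n A w) (μ : PMF (Fin n → A)) : ℝ :=
  ∑ x, (μ x).toReal * ((w : ℝ) * ((D.enc x).length : ℝ))

/-- Every file can be decoded with at most `t` probes. -/
def Scheme.DecodesWithin (D : Scheme n A w) (μ : PMF (Fin n → A)) (t : ℕ) : Prop :=
  ∀ x ∈ μ.support, ∀ i, (D.dec i).probes (D.enc x) ≤ t

/-- Every single file is uniformly distributed on the alphabet. -/
def UniformMarginals [Fintype A] [Nonempty A] (μ : PMF (Fin n → A)) : Prop :=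
  ∀ i, μ.map (fun x => x i) = PMF.uniformOfFintype A

/-- Any at most `k` of the files are mutually independent. -/
def KWiseIndependent (μ : PMF (Fin n → A)) (k : ℕ) : Prop :=
  ∀ S : Finset (Fin n), S.card ≤ k → ∀ a : Fin n → A,
    μ.toOuterMeasure {x | ∀ i ∈ S, x i = a i} = ∏ i ∈ S, (μ.map (fun x => x i)) (a i)

/-- The joint law of `(f 1 Y, …, f n Y)` for a uniformly random `h`-bit string `Y`. -/
noncomputable def functionsLaw {h : ℕ} (f : Fin n → (Fin h → Bool) → A) : PMF (Fin n → A) :=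
  (PMF.uniformOfFintype (Fin h → Bool)).map (fun y i => f i y)

/-- The law `μ` has entropy `h` and is hard at precision `δ`: with any word-size-`w` scheme, either
decoding takes at least `h ^ (1 - δ)` probes or more than `n ^ (1 - δ)` bits of (expected) memory
are used. -/
def IsHard [Fintype A] (h w : ℕ) (δ : ℝ) (μ : PMF (Fin n → A)) : Prop :=
  entropy μ = h ∧
    ∀ (D : Scheme n A w) (t : ℕ), D.Solves μ → D.DecodesWithin μ t →
      (h : ℝ) ^ (1 - δ) ≤ t ∨ (n : ℝ) ^ (1 - δ) < D.expectedBits μ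

end LDSC

/-!
Both lower bounds compare the information in a short memory with what its decoders recover from it.

For a `k`-wise independent distribution of entropy `H`, suppose that `t` is a small multiple of
`log H`. Half of the inputs use at most `m = 2 C H / w` cells. On such an input, averaging over the
sets of `s = m / r` cells gives a sample that contains all probes of a fraction `(2 r) ^ (-t)` of
the queries (`exists_sample_set`), and this is at least `H / (C log |A|)` files, because `n` is at
least `H ^ (1 + ε)`. The sampled addresses and contents predict these files without any further
information, since a decoder can be run until it leaves the sample. A fixed sample predicts `k`
independent uniform files correctly with probability at most `|A| ^ (-k)`, so the union bound over
the samples forces `|A| ^ k ≤ 2 * (m choose s) * (2 ^ w + 1) ^ s`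
(`card_pow_le_two_mul_card_sample`). The right hand side has only `O(H log r / r)` bits
(`logb_card_sample_le`), which is impossible for a large constant `r`
(`not_decodesWithin_of_large`).

For the laws of `n` functions of a random `h`-bit string the argument is a count. A decoder with `T`
probes is a decision tree described by about `2 ^ (w T)` symbols, far less than the `2 ^ h` values
of the function it computes. If a scheme with small expected memory exists, then, for at least half
of the strings `y`, all values `f i y` are computed by such trees from a memory that is much shorter
than `n` bits. There are few such tuples `f` (`ncard_computed_le`), and few tuples for which the map
`y ↦ (f 1 y, …, f n y)` has a collision (`ncard_not_injective_le`); every other tuple is hard and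
its law has entropy `h`. The string `y` itself, stored and read completely, gives the matching upper
bound (`exists_tight_scheme`).
-/

namespace LDSC

/-! ### Finite sums over probability mass functions -/

theorem sum_toReal_pmf {α : Type*} [Fintype α] (p : PMF α) : ∑ x, (p x).toReal = 1 := by
  rw [← ENNReal.toReal_sum (fun x _ => p.apply_ne_top x),
    ← tsum_fintype (L := .unconditional _), p.tsum_coe]
  rfl

/-- The law of the unconscious statistician on finite types. -/
theorem sum_map_toReal_mul {α β : Type*} [Fintype α] [Fintype β] (p : PMF α) (F : α → β)
    (g : β → ℝ) :
    ∑ x, (p.map F x).toReal * g x = ∑ y, (p y).toReal * g (F y) := by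
  classical
  have key : ∀ x, (p.map F x).toReal = ∑ y, if x = F y then (p y).toReal else 0 := by
    intro x
    rw [PMF.map_apply, tsum_fintype, ENNReal.toReal_sum]
    · refine Finset.sum_congr rfl fun y _ => ?_
      split_ifs <;> simp
    · intro y _
      split_ifs
      · exact p.apply_ne_top y
      · simp
  simp_rw [key, Finset.sum_mul]
  rw [Finset.sum_comm]
  refine Finset.sum_congr rfl fun y _ => ?_
  rw [Finset.sum_eq_single (F y)]
  · simp
  · intro x _ hx
    simp [hx]
  · simp

/-- Markov's inequality for the memory size: with probability at least one half, at most twice the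
expected number of bits is used. -/
theorem half_le_prob_short {n : ℕ} {A : Type*} [Fintype A] {w : ℕ} (D : Scheme n A w)
    (μ : PMF (Fin n → A)) {B : ℝ} (hB : 0 < B) (h : D.expectedBits μ ≤ B) :
    1 / 2 ≤ ∑ x, (μ x).toReal *
      (if (w : ℝ) * ((D.enc x).length : ℝ) ≤ 2 * B then 1 else 0) := by
  have h1 : ∀ x, (μ x).toReal - (μ x).toReal * ((w : ℝ) * ((D.enc x).length : ℝ)) / (2 * B) ≤
      (μ x).toReal * (if (w : ℝ) * ((D.enc x).length : ℝ) ≤ 2 * B then 1 else 0) := by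
    intro x
    have hp : 0 ≤ (μ x).toReal := ENNReal.toReal_nonneg
    have hl : (0 : ℝ) ≤ (w : ℝ) * ((D.enc x).length : ℝ) := by positivity
    split_ifs with hx
    · have : 0 ≤ (μ x).toReal * ((w : ℝ) * ((D.enc x).length : ℝ)) / (2 * B) := by positivity
      linarith
    · push Not at hx
      have : 1 ≤ ((w : ℝ) * ((D.enc x).length : ℝ)) / (2 * B) := by
        rw [le_div_iff₀ (by positivity)]
        linarith
      rw [mul_div_assoc]
      nlinarith
  have h2 := Finset.sum_le_sum fun x (_ : x ∈ Finset.univ) => h1 x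
  rw [Finset.sum_sub_distrib, sum_toReal_pmf, ← Finset.sum_div] at h2
  have h3 : (∑ x, (μ x).toReal * ((w : ℝ) * ((D.enc x).length : ℝ))) / (2 * B) ≤ 1 / 2 := by
    rw [div_le_iff₀ (by positivity)]
    have h4 : ∑ x, (μ x).toReal * ((w : ℝ) * ((D.enc x).length : ℝ)) ≤ B := h
    linarith
  linarith

/-! ### An optimal scheme that reads the whole memory -/

/-- The algorithm that probes the cells `0, …, c - 1` and then applies `out` to what it has read,
given as a function of the address that is `none` off the cells read. -/
def ProbeAlg.readAll {w : ℕ} {A : Type*} : (c : ℕ) → ((ℕ → Option (Cell w)) → A) → ProbeAlg w A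
  | 0, out => .answer (out fun _ => none)
  | c + 1, out => .probe c fun o => readAll c fun g => out (Function.update g c o)

theorem ProbeAlg.output_readAll {w : ℕ} {A : Type*} (M : Memory w) (c : ℕ)
    (out : (ℕ → Option (Cell w)) → A) :
    (readAll c out).output M = out fun j => if j < c then M[j]? else none := by
  induction c generalizing out with
  | zero => simp [readAll, output]
  | succ c ih =>
    simp only [readAll, output, ih]
    congr 1
    funext j
    by_cases hj : j = c
    · subst hj
      simp
    · rw [Function.update_of_ne hj]
      have : j < c + 1 ↔ j < c := by omega
      simp [this]

theorem ProbeAlg.probes_readAll {w : ℕ} {A : Type*} (M : Memory w) (c : ℕ)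
    (out : (ℕ → Option (Cell w)) → A) : (readAll c out).probes M = c := by
  induction c generalizing out with
  | zero => simp [readAll, probes]
  | succ c ih => simp [readAll, probes, ih]

/-- An `h`-bit string written into `c` cells of `w` bits, padded with `false`. -/
def writeBits {h : ℕ} (w c : ℕ) (y : Fin h → Bool) : Memory w :=
  List.ofFn fun (j : Fin c) (b : Fin w) =>
    if hlt : j.1 * w + b.1 < h then y ⟨j.1 * w + b.1, hlt⟩ else false

/-- The `h`-bit string stored in a family of `w`-bit cells, where missing cells are read as
`false`. -/
def readBits (h : ℕ) {w : ℕ} (hw : 0 < w) (g : ℕ → Option (Cell w)) : Fin h → Bool :=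
  fun b => (g (b.1 / w)).elim false fun cell => cell ⟨b.1 % w, Nat.mod_lt _ hw⟩

theorem readBits_writeBits {h w c : ℕ} (hw : 0 < w) (hc : h ≤ c * w) (y : Fin h → Bool) :
    readBits h hw (fun j => if j < c then (writeBits w c y)[j]? else none) = y := by
  funext b
  have hb : b.1 / w < c := by
    rw [Nat.div_lt_iff_lt_mul hw]
    exact b.2.trans_le hc
  have he : b.1 / w * w + b.1 % w = b.1 := Nat.div_add_mod' _ _
  simp [readBits, writeBits, hb, he]

theorem mem_support_functionsLaw {n h : ℕ} {A : Type*} (f : Fin n → (Fin h → Bool) → A)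
    (x : Fin n → A) : x ∈ (functionsLaw f).support ↔ ∃ y, (fun i => f i y) = x := by
  simp [functionsLaw]

/-- Storing a preimage `y` of the files in `⌈h / w⌉` cells, and reading it completely for every
query, is optimal in space. -/
theorem exists_tight_scheme (n h w : ℕ) (A : Type) [Fintype A] (f : Fin n → (Fin h → Bool) → A)
    (hw : 1 ≤ w) :
    ∃ D : Scheme n A w, D.Solves (functionsLaw f) ∧
      D.DecodesWithin (functionsLaw f) ⌈(h : ℝ) / w⌉₊ ∧
      D.expectedBits (functionsLaw f) ≤ (h : ℝ) + w := by
  set c := ⌈(h : ℝ) / w⌉₊ with hcdef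
  have hw0 : (0 : ℝ) < w := by exact_mod_cast hw
  have hc : h ≤ c * w := by
    have : (h : ℝ) / w ≤ c := Nat.le_ceil _
    rw [div_le_iff₀ hw0] at this
    exact_mod_cast this
  have hc2 : (w : ℝ) * c ≤ h + w := by
    have : (c : ℝ) < (h : ℝ) / w + 1 := Nat.ceil_lt_add_one (by positivity)
    have h2 : (w : ℝ) * c ≤ w * ((h : ℝ) / w + 1) := by gcongr
    rwa [mul_add, mul_div_cancel₀ _ hw0.ne', mul_one] at h2
  refine ⟨⟨fun x => writeBits w c (Function.invFun (fun y i => f i y) x),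
    fun i => .readAll c fun g => f i (readBits h hw g)⟩, ?_, ?_, ?_⟩
  · intro x hx i
    obtain ⟨y, hy⟩ := (mem_support_functionsLaw f x).1 hx
    simp only [ProbeAlg.output_readAll, readBits_writeBits hw hc]
    exact congrFun (Function.invFun_eq (f := fun y i => f i y) ⟨y, hy⟩) i
  · intro x _ i
    simp [ProbeAlg.probes_readAll]
  · simp only [Scheme.expectedBits, writeBits, List.length_ofFn]
    rw [← Finset.sum_mul, sum_toReal_pmf, one_mul]
    exact hc2

/-! ### Counting decoders of bounded depth -/

/-- Decision trees of depth exactly `t` over a memory of `m` optional cells, with outputs in `A`. The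
probe `none` stands for every address beyond the memory, and always returns a blank. -/
def ProbeTree (m w : ℕ) (A : Type) : ℕ → Type
  | 0 => A
  | t + 1 => Option (Fin m) × (Option (Cell w) → ProbeTree m w A t)

/-- The output of a decision tree on a memory state. -/
def ProbeTree.eval {m w : ℕ} {A : Type} (M : Fin m → Option (Cell w)) :
    (t : ℕ) → ProbeTree m w A t → A
  | 0, a => a
  | t + 1, T => eval M t (T.2 (T.1.bind M))

instance ProbeTree.finite (m w : ℕ) (A : Type) [Finite A] : (t : ℕ) → Finite (ProbeTree m w A t)
  | 0 => inferInstanceAs (Finite A)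
  | t + 1 =>
    have := ProbeTree.finite m w A t
    inferInstanceAs (Finite (Option (Fin m) × (Option (Cell w) → ProbeTree m w A t)))

theorem card_option_cell (w : ℕ) : Nat.card (Option (Cell w)) = 2 ^ w + 1 := by
  simp [Cell]

theorem ProbeTree.card_le (m w : ℕ) (A : Type) [Finite A] [Nonempty A] (t : ℕ) :
    Nat.card (ProbeTree m w A t) ≤ ((m + 1) * Nat.card A) ^ ((2 ^ w + 2) ^ t) := by
  have hA : 0 < Nat.card A := Nat.card_pos
  induction t with
  | zero =>
    change Nat.card A ≤ _
    simp only [pow_zero, pow_one]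
    nlinarith
  | succ t ih =>
    change Nat.card (Option (Fin m) × (Option (Cell w) → ProbeTree m w A t)) ≤ _
    rw [Nat.card_prod, Nat.card_fun, card_option_cell]
    have h1 : Nat.card (Option (Fin m)) = m + 1 := by simp
    rw [h1]
    set B := (m + 1) * Nat.card A with hB
    have h2 : m + 1 ≤ B ^ ((2 ^ w + 2) ^ t) :=
      (Nat.le_mul_of_pos_right _ hA).trans (Nat.le_self_pow (by positivity) _)
    calc (m + 1) * Nat.card (ProbeTree m w A t) ^ (2 ^ w + 1)
        ≤ B ^ ((2 ^ w + 2) ^ t) * (B ^ ((2 ^ w + 2) ^ t)) ^ (2 ^ w + 1) := by gcongr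
      _ = B ^ ((2 ^ w + 2) ^ (t + 1)) := by
        rw [← pow_mul, ← pow_add]
        congr 1
        ring

/-- On memories of at most `m` cells on which it makes at most `t` probes, a cell-probe algorithm
agrees with a decision tree of depth `t`. -/
theorem ProbeAlg.exists_probeTree {w : ℕ} {A : Type} [Nonempty A] (m t : ℕ) (P : ProbeAlg w A) :
    ∃ T : ProbeTree m w A t, ∀ M : Memory w, M.length ≤ m → P.probes M ≤ t →
      ProbeTree.eval (fun j => M[j.1]?) t T = P.output M := by
  induction t generalizing P with
  | zero =>
    cases P with
    | answer a => exact ⟨a, fun M _ _ => rfl⟩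
    | probe addr next => exact ⟨Classical.arbitrary A, fun M _ h => by simp [probes] at h⟩
  | succ t ih =>
    cases P with
    | answer a =>
      obtain ⟨T, hT⟩ := ih (.answer a)
      exact ⟨(none, fun _ => T), fun M hM _ => hT M hM (by simp [probes])⟩
    | probe addr next =>
      choose T hT using fun o => ih (next o)
      refine ⟨(if h : addr < m then some ⟨addr, h⟩ else none, T), fun M hM hP => ?_⟩
      have key : (if h : addr < m then some (⟨addr, h⟩ : Fin m) else none).bind
          (fun j => M[j.1]?) = M[addr]? := by
        split_ifs with h
        · rfl
        · rw [List.getElem?_eq_none (by omega)]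
          rfl
      change ProbeTree.eval _ t (T (Option.bind _ _)) = _
      rw [key]
      exact hT _ M hM (by simpa [probes] using hP)

/-! ### Counting tuples of functions -/

theorem ncard_le_of_subset_range {α β : Type*} [Finite α] {s : Set β} (φ : α → β)
    (h : s ⊆ Set.range φ) : s.ncard ≤ Nat.card α :=
  (Set.ncard_le_ncard h (Set.finite_range φ)).trans (Finite.card_range_le φ)

theorem ncard_not_injective_le (n : ℕ) (Y A : Type) [Fintype Y] [Finite A] [Nonempty A] :
    {f : Fin n → Y → A | ¬ Function.Injective fun y i => f i y}.ncard ≤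
      Fintype.card Y ^ 2 * Nat.card A ^ (n * (Fintype.card Y - 1)) := by
  classical
  -- A tuple with a collision is determined by the collision `p` and its values off `p.2`.
  let φ : (Σ p : Y × Y, {z // z ≠ p.2} → Fin n → A) → Fin n → Y → A := fun c i z =>
    if h : z ≠ c.1.2 then c.2 ⟨z, h⟩ i
    else if h' : c.1.1 ≠ c.1.2 then c.2 ⟨c.1.1, h'⟩ i else Classical.arbitrary A
  refine (ncard_le_of_subset_range φ ?_).trans (le_of_eq ?_)
  · intro f hf
    simp only [Set.mem_ofPred_eq, Function.Injective] at hf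
    push Not at hf
    obtain ⟨y, y', hyy, hne⟩ := hf
    refine ⟨⟨(y, y'), fun z i => f i z.1⟩, ?_⟩
    funext i z
    by_cases hz : z = y'
    · subst hz
      simpa [φ, hne] using congrFun hyy i
    · simp [φ, hz]
  · rw [Nat.card_sigma]
    have : ∀ p : Y × Y, Nat.card ({z // z ≠ p.2} → Fin n → A) =
        Nat.card A ^ (n * (Fintype.card Y - 1)) := by
      intro p
      rw [Nat.card_fun, Nat.card_fun, Nat.card_fin, ← pow_mul]
      congr 2
      rw [Nat.card_eq_fintype_card, Fintype.card_subtype_compl, Fintype.card_subtype_eq]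
    simp only [this, Finset.sum_const, Finset.card_univ, Fintype.card_prod, smul_eq_mul, sq]

/-- Few tuples of functions agree, on at least half of their domain, with `n` decision trees of depth
`T` applied to a common memory of `m` optional cells. -/
theorem ncard_computed_le (n m w T : ℕ) (Y A : Type) [Fintype Y] [Finite A] [Nonempty A] :
    {f : Fin n → Y → A | ∃ G : Finset Y, Fintype.card Y ≤ 2 * G.card ∧
      ∃ (e : Y → Fin m → Option (Cell w)) (τ : Fin n → ProbeTree m w A T),
        ∀ y ∈ G, ∀ i, f i y = ProbeTree.eval (e y) T (τ i)}.ncard ≤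
      2 ^ Fintype.card Y * (((2 ^ w + 1) ^ m) ^ Fintype.card Y *
        ((((m + 1) * Nat.card A) ^ ((2 ^ w + 2) ^ T)) ^ n *
          Nat.card A ^ (n * (Fintype.card Y / 2)))) := by
  classical
  let φ : (Σ G : {G : Finset Y // Fintype.card Y ≤ 2 * G.card},
      (Y → Fin m → Option (Cell w)) × (Fin n → ProbeTree m w A T) ×
        ({y // y ∉ G.1} → Fin n → A)) → Fin n → Y → A := fun c i y =>
    if h : y ∈ c.1.1 then ProbeTree.eval (c.2.1 y) T (c.2.2.1 i) else c.2.2.2 ⟨y, h⟩ i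
  refine (ncard_le_of_subset_range φ ?_).trans ?_
  · rintro f ⟨G, hG, e, τ, h⟩
    refine ⟨⟨⟨G, hG⟩, e, τ, fun y i => f i y.1⟩, ?_⟩
    funext i y
    by_cases hy : y ∈ G
    · simp [φ, hy, h y hy i]
    · simp [φ, hy]
  · rw [Nat.card_sigma]
    refine (Finset.sum_le_card_nsmul _ _ (((2 ^ w + 1) ^ m) ^ Fintype.card Y *
        ((((m + 1) * Nat.card A) ^ ((2 ^ w + 2) ^ T)) ^ n *
          Nat.card A ^ (n * (Fintype.card Y / 2)))) ?_).trans ?_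
    · intro G _
      rw [Nat.card_prod, Nat.card_prod, Nat.card_fun, Nat.card_fun, Nat.card_fun, Nat.card_fun,
        Nat.card_fun, card_option_cell, Nat.card_fin, Nat.card_fin, ← pow_mul (Nat.card A),
        Nat.card_eq_fintype_card (α := Y)]
      gcongr
      · exact ProbeTree.card_le m w A T
      · exact Nat.card_pos
      · rw [Nat.card_eq_fintype_card, Fintype.card_subtype_compl, Fintype.card_coe]
        have := G.2
        omega
    · rw [smul_eq_mul]
      gcongr
      rw [Finset.card_univ, ← Fintype.card_finset]
      exact Fintype.card_subtype_le _

/-! ### Hardness of most laws of functions -/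

theorem entropy_functionsLaw_of_injective {n h : ℕ} {A : Type} [Fintype A]
    (f : Fin n → (Fin h → Bool) → A) (hf : Function.Injective fun y i => f i y) :
    entropy (functionsLaw f) = h := by
  have hv : ∀ y, (functionsLaw f fun i => f i y).toReal = ((2 : ℝ) ^ h)⁻¹ := by
    intro y
    classical
    rw [functionsLaw, PMF.map_apply, tsum_eq_single y]
    · simp
    · intro y' hy'
      rw [if_neg]
      exact fun h => hy' (hf h).symm
  have h1 : ∑ x, Real.negMulLog (functionsLaw f x).toReal =
      ∑ x, (functionsLaw f x).toReal * -Real.log (functionsLaw f x).toReal :=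
    Finset.sum_congr rfl fun x _ => by rw [Real.negMulLog]; ring
  have h2 := sum_map_toReal_mul (PMF.uniformOfFintype (Fin h → Bool)) (fun y i => f i y)
    (fun x => -Real.log (functionsLaw f x).toReal)
  rw [entropy, h1]
  change (∑ x, (functionsLaw f x).toReal * _) = _ at h2
  rw [h2]
  simp_rw [hv]
  rw [← Finset.sum_mul, sum_toReal_pmf, Real.log_inv, Real.log_pow]
  field_simp [(Real.log_pos one_lt_two).ne']

/-- An easy law of functions comes from a tuple that is computed by shallow decision trees on at
least half of its domain. -/
theorem exists_trees_of_scheme {n h w : ℕ} {A : Type} [Fintype A] [Nonempty A]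
    (f : Fin n → (Fin h → Bool) → A) (D : Scheme n A w) {t T m : ℕ} (ht : t ≤ T)
    (hD : D.Solves (functionsLaw f)) (hP : D.DecodesWithin (functionsLaw f) t) {B : ℝ} (hB : 0 < B)
    (hE : D.expectedBits (functionsLaw f) ≤ B)
    (hm : ∀ l : ℕ, (w : ℝ) * l ≤ 2 * B → l ≤ m) :
    ∃ G : Finset (Fin h → Bool), Fintype.card (Fin h → Bool) ≤ 2 * G.card ∧
      ∃ (e : (Fin h → Bool) → Fin m → Option (Cell w)) (τ : Fin n → ProbeTree m w A T),
        ∀ y ∈ G, ∀ i, f i y = ProbeTree.eval (e y) T (τ i) := by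
  classical
  choose τ hτ using fun i => (D.dec i).exists_probeTree m T
  refine ⟨Finset.univ.filter fun y => (w : ℝ) * ((D.enc fun i => f i y).length : ℝ) ≤ 2 * B, ?_,
    fun y j => (D.enc fun i => f i y)[j.1]?, τ, ?_⟩
  · have h1 := half_le_prob_short D _ hB hE
    have h2 := sum_map_toReal_mul (PMF.uniformOfFintype (Fin h → Bool)) (fun y i => f i y)
      (fun x => if (w : ℝ) * ((D.enc x).length : ℝ) ≤ 2 * B then 1 else 0)
    change (∑ x, (functionsLaw f x).toReal * _) = _ at h2
    rw [h2] at h1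
    simp only [PMF.uniformOfFintype_apply, ← Finset.mul_sum, Finset.sum_boole] at h1
    rw [ENNReal.toReal_inv, ENNReal.toReal_natCast, inv_mul_eq_div,
      le_div_iff₀ (by exact_mod_cast Fintype.card_pos)] at h1
    have h3 : (Fintype.card (Fin h → Bool) : ℝ) ≤
        2 * ((Finset.univ.filter fun y : Fin h → Bool =>
          (w : ℝ) * ((D.enc fun i => f i y).length : ℝ) ≤ 2 * B).card : ℝ) := by linarith
    exact_mod_cast h3
  · intro y hy i
    have hs : (fun i => f i y) ∈ (functionsLaw f).support :=
      (mem_support_functionsLaw f _).2 ⟨y, rfl⟩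
    rw [hτ i _ (hm _ (Finset.mem_filter.1 hy).2) ((hP _ hs i).trans ht), hD _ hs i]

/-- The arithmetic behind the count of tuples computed by trees: the description of the half on
which the trees are correct is much shorter than a table of its values. -/
theorem computed_bound_mul_le {n h m w T M a : ℕ} (ha : 2 ≤ a) (hw : 1 ≤ w) (hn : 16 ≤ n)
    (hM : 32 * M ≤ n) (hwm : w * m ≤ M) (hm : m + 1 ≤ 2 ^ h)
    (hT : 16 * (h + 1) * 2 ^ (2 * w * T) ≤ 2 ^ h) :
    2 ^ 2 ^ h * (((2 ^ w + 1) ^ m) ^ 2 ^ h *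
      ((((m + 1) * a) ^ ((2 ^ w + 2) ^ T)) ^ n * a ^ (n * (2 ^ h / 2)))) * 2 ^ h ≤
      a ^ (n * 2 ^ h) := by
  set N := 2 ^ h with hN
  have hQ2 : 2 ^ w + 2 ≤ 2 ^ (2 * w) := by
    have h1 : 2 ≤ 2 ^ w := Nat.le_self_pow (by omega) 2
    rw [two_mul, pow_add]
    nlinarith
  have hQ : (2 ^ w + 1) ^ m ≤ a ^ (2 * M) := by
    calc (2 ^ w + 1) ^ m ≤ (2 ^ (2 * w)) ^ m := Nat.pow_le_pow_left (by omega) m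
      _ = 2 ^ (2 * (w * m)) := by rw [← pow_mul, mul_assoc]
      _ ≤ 2 ^ (2 * M) := Nat.pow_le_pow_right (by norm_num) (by omega)
      _ ≤ a ^ (2 * M) := Nat.pow_le_pow_left ha _
  have hTr : (2 ^ w + 2) ^ T ≤ 2 ^ (2 * w * T) := by
    rw [pow_mul]
    exact Nat.pow_le_pow_left hQ2 T
  have hB : (m + 1) * a ≤ a ^ (h + 1) := by
    rw [pow_succ]
    exact Nat.mul_le_mul_right _ (hm.trans (Nat.pow_le_pow_left ha h))
  have h1 : ((m + 1) * a) ^ ((2 ^ w + 2) ^ T) ≤ a ^ ((h + 1) * 2 ^ (2 * w * T)) := by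
    rw [pow_mul]
    exact (Nat.pow_le_pow_left hB _).trans (Nat.pow_le_pow_right (by positivity) hTr)
  have hhN : h < N := Nat.lt_two_pow_self
  calc 2 ^ N * (((2 ^ w + 1) ^ m) ^ N *
      ((((m + 1) * a) ^ ((2 ^ w + 2) ^ T)) ^ n * a ^ (n * (N / 2)))) * 2 ^ h
      ≤ a ^ N * ((a ^ (2 * M)) ^ N *
        ((a ^ ((h + 1) * 2 ^ (2 * w * T))) ^ n * a ^ (n * (N / 2)))) * a ^ h := by gcongr
    _ = a ^ (N + (2 * M * N + ((h + 1) * 2 ^ (2 * w * T) * n + n * (N / 2))) + h) := by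
      simp only [← pow_mul, ← pow_add]
    _ ≤ a ^ (n * N) := by
      apply Nat.pow_le_pow_right (by omega)
      have e1 : 16 * N ≤ n * N := Nat.mul_le_mul_right _ hn
      have e2 : 32 * M * N ≤ n * N := Nat.mul_le_mul_right _ hM
      have e3 : 16 * (h + 1) * 2 ^ (2 * w * T) * n ≤ N * n := Nat.mul_le_mul_right _ hT
      have e4 : n * (2 * (N / 2)) ≤ n * N := Nat.mul_le_mul_left _ (Nat.mul_div_le N 2)
      nlinarith

theorem not_injective_bound_mul_le {n h a : ℕ} (ha : 2 ≤ a) (hn : 4 * h ≤ n) :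
    (2 ^ h) ^ 2 * a ^ (n * (2 ^ h - 1)) * 2 ^ h ≤ a ^ (n * 2 ^ h) := by
  calc (2 ^ h) ^ 2 * a ^ (n * (2 ^ h - 1)) * 2 ^ h
      ≤ (a ^ h) ^ 2 * a ^ (n * (2 ^ h - 1)) * a ^ h := by gcongr
    _ = a ^ (h * 2 + n * (2 ^ h - 1) + h) := by simp only [← pow_mul, ← pow_add]
    _ ≤ a ^ (n * 2 ^ h) := by
      apply Nat.pow_le_pow_right (by omega)
      have : 1 ≤ 2 ^ h := Nat.one_le_two_pow
      obtain ⟨N, hN⟩ := Nat.exists_eq_add_of_le this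
      rw [hN, Nat.add_sub_cancel_left, mul_add]
      omega

open Filter Topology in
theorem eventually_hard_parameters {δ : ℝ} (hδ : 0 < δ) (hδ1 : δ < 1) :
    ∀ᶠ h : ℕ in atTop, 4 ≤ h ∧ 2 ≤ δ * 2 ^ h ∧ 64 ≤ (h : ℝ) ^ δ ∧
      16 * ((h : ℝ) + 1) * (2 : ℝ) ^ (2 * (h : ℝ) ^ (1 - δ / 2)) ≤ 2 ^ (h : ℝ) := by
  have h1 : ∀ᶠ h : ℕ in atTop, 2 / δ ≤ (2 : ℝ) ^ h :=
    (tendsto_pow_atTop_atTop_of_one_lt one_lt_two).eventually_ge_atTop _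
  have h2 : ∀ᶠ h : ℕ in atTop, 64 ≤ (h : ℝ) ^ δ :=
    ((tendsto_rpow_atTop hδ).comp tendsto_natCast_atTop_atTop).eventually_ge_atTop _
  have h3 : ∀ᶠ h : ℕ in atTop, 4 ≤ (h : ℝ) ^ (δ / 2) :=
    ((tendsto_rpow_atTop (half_pos hδ)).comp tendsto_natCast_atTop_atTop).eventually_ge_atTop _
  have hs : (1 : ℝ) < √2 := by
    rw [Real.lt_sqrt (by norm_num)]
    norm_num
  have h4 : ∀ᶠ h : ℕ in atTop, ‖(h : ℝ)‖ ≤ 1 / 32 * ‖√2 ^ h‖ :=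
    (isLittleO_coe_const_pow_of_one_lt (R := ℝ) hs).bound (by norm_num)
  filter_upwards [h1, h2, h3, h4, eventually_ge_atTop 4] with h h1 h2 h3 h4 h5
  refine ⟨h5, ?_, h2, ?_⟩
  · rwa [div_le_iff₀' hδ] at h1
  · have hp : (0 : ℝ) < h := by
      have : 0 < h := by omega
      exact_mod_cast this
    have e1 : 16 * ((h : ℝ) + 1) ≤ 2 ^ ((h : ℝ) / 2) := by
      have : (2 : ℝ) ^ ((h : ℝ) / 2) = √2 ^ h := by
        rw [Real.sqrt_eq_rpow, ← Real.rpow_natCast, ← Real.rpow_mul (by norm_num)]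
        congr 1
        ring
      rw [this]
      rw [Real.norm_of_nonneg (by positivity), Real.norm_of_nonneg (by positivity)] at h4
      have : (4 : ℝ) ≤ h := by exact_mod_cast h5
      linarith
    have e2 : 2 * (h : ℝ) ^ (1 - δ / 2) ≤ h / 2 := by
      rw [Real.rpow_sub hp, Real.rpow_one, ← mul_div_assoc, div_le_iff₀ (by positivity)]
      nlinarith
    calc 16 * ((h : ℝ) + 1) * (2 : ℝ) ^ (2 * (h : ℝ) ^ (1 - δ / 2))
        ≤ 2 ^ ((h : ℝ) / 2) * 2 ^ ((h : ℝ) / 2) := by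
          gcongr
          norm_num
      _ = 2 ^ (h : ℝ) := by rw [← Real.rpow_add (by norm_num), add_halves]

/-- For most tuples of functions the law has full entropy and is hard. -/
theorem exists_hard_threshold {δ : ℝ} (hδ : 0 < δ) :
    ∃ h₀ : ℕ, ∀ (n h w : ℕ) (A : Type) [Fintype A] [Nontrivial A],
        h₀ ≤ h → 4 * h ≤ n → Real.logb 2 n ≤ (h : ℝ) ^ (δ / 2) →
        1 ≤ w → (w : ℝ) ≤ (h : ℝ) ^ (δ / 2) →
        (1 - δ) * (Nat.card (Fin n → (Fin h → Bool) → A) : ℝ) ≤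
          ({f : Fin n → (Fin h → Bool) → A | IsHard h w δ (functionsLaw f)}.ncard : ℝ) := by
  rcases le_or_gt 1 δ with hδ1 | hδ1
  · refine ⟨0, fun n h w A _ _ _ _ _ _ _ => le_trans ?_ (Nat.cast_nonneg _)⟩
    exact mul_nonpos_of_nonpos_of_nonneg (by linarith) (Nat.cast_nonneg _)
  obtain ⟨h₀, hh₀⟩ := Filter.eventually_atTop.1 (eventually_hard_parameters hδ hδ1)
  refine ⟨h₀, fun n h w A _ _ hh hn hlog hw hwh => ?_⟩
  obtain ⟨p1, p2, p3, p4⟩ := hh₀ h hh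
  have hh0 : (4 : ℝ) ≤ h := by exact_mod_cast p1
  have hhn : (h : ℝ) ≤ n := by exact_mod_cast (show h ≤ n by omega)
  have hnpos : (0 : ℝ) < n := by linarith
  have ha : 2 ≤ Nat.card A := by
    rw [Nat.card_eq_fintype_card]
    exact Fintype.one_lt_card
  have hBpos : (0 : ℝ) < (n : ℝ) ^ (1 - δ) := by positivity
  set M := ⌊2 * (n : ℝ) ^ (1 - δ)⌋₊ with hMdef
  set T := ⌊(h : ℝ) ^ (1 - δ)⌋₊ with hTdef
  have hM : 32 * M ≤ n := by
    have e1 : (M : ℝ) ≤ 2 * (n : ℝ) ^ (1 - δ) := Nat.floor_le (by positivity)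
    have e2 : 64 * (n : ℝ) ^ (1 - δ) ≤ n := by
      have : (64 : ℝ) ≤ (n : ℝ) ^ δ := p3.trans (by gcongr)
      rw [Real.rpow_sub hnpos, Real.rpow_one, ← mul_div_assoc, div_le_iff₀ (by positivity)]
      nlinarith
    have : 32 * (M : ℝ) ≤ n := by linarith
    exact_mod_cast this
  have hn2 : n ≤ 2 ^ h := by
    have e1 : Real.logb 2 n ≤ h := hlog.trans (by
      calc (h : ℝ) ^ (δ / 2) ≤ (h : ℝ) ^ (1 : ℝ) :=
            Real.rpow_le_rpow_of_exponent_le (by linarith) (by linarith)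
        _ = h := Real.rpow_one _)
    rw [Real.logb_le_iff_le_rpow one_lt_two hnpos, Real.rpow_natCast] at e1
    exact_mod_cast e1
  have hwm : w * (M / w) ≤ M := Nat.mul_div_le M w
  have hm : M / w + 1 ≤ 2 ^ h := by
    have := Nat.div_le_self M w
    omega
  have hT : 16 * (h + 1) * 2 ^ (2 * w * T) ≤ 2 ^ h := by
    have e1 : (T : ℝ) ≤ (h : ℝ) ^ (1 - δ) := Nat.floor_le (by positivity)
    have e2 : (2 * w * T : ℝ) ≤ 2 * (h : ℝ) ^ (1 - δ / 2) := by
      have : (h : ℝ) ^ (1 - δ / 2) = (h : ℝ) ^ (δ / 2) * (h : ℝ) ^ (1 - δ) := by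
        rw [← Real.rpow_add (by linarith)]
        congr 1
        ring
      rw [this, mul_assoc]
      gcongr
    have e3 : (2 : ℝ) ^ (2 * w * T : ℝ) ≤ (2 : ℝ) ^ (2 * (h : ℝ) ^ (1 - δ / 2)) :=
      Real.rpow_le_rpow_of_exponent_le (by norm_num) e2
    have e4 : (16 * ((h : ℝ) + 1)) * (2 : ℝ) ^ (2 * w * T : ℝ) ≤ 2 ^ (h : ℝ) :=
      le_trans (by gcongr) p4
    have e5 : (2 : ℝ) ^ (2 * w * T : ℝ) = (2 : ℝ) ^ (2 * w * T) := by
      rw [← Real.rpow_natCast]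
      push_cast
      rfl
    rw [e5, Real.rpow_natCast] at e4
    exact_mod_cast e4
  set F := Fin n → (Fin h → Bool) → A
  have hcardY : Fintype.card (Fin h → Bool) = 2 ^ h := by simp
  have htot : Nat.card F = Nat.card A ^ (n * 2 ^ h) := by
    simp only [F]
    rw [Nat.card_fun, Nat.card_fun, Nat.card_fin, Nat.card_eq_fintype_card (α := Fin h → Bool),
      hcardY, ← pow_mul, mul_comm]
  set S₁ := {f : F | ¬ Function.Injective fun y i => f i y} with hS₁
  set S₂ := {f : F | ∃ G : Finset (Fin h → Bool), Fintype.card (Fin h → Bool) ≤ 2 * G.card ∧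
      ∃ (e : (Fin h → Bool) → Fin (M / w) → Option (Cell w))
        (τ : Fin n → ProbeTree (M / w) w A T),
        ∀ y ∈ G, ∀ i, f i y = ProbeTree.eval (e y) T (τ i)} with hS₂
  have hc₁ : S₁.ncard * 2 ^ h ≤ Nat.card F := by
    rw [htot]
    refine le_trans ?_ (not_injective_bound_mul_le ha hn)
    have := ncard_not_injective_le n (Fin h → Bool) A
    rw [hcardY] at this
    exact Nat.mul_le_mul_right _ this
  have hc₂ : S₂.ncard * 2 ^ h ≤ Nat.card F := by
    rw [htot]
    refine le_trans ?_ (computed_bound_mul_le ha hw (by omega) hM hwm hm hT)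
    have := ncard_computed_le n (M / w) w T (Fin h → Bool) A
    refine Nat.mul_le_mul_right _ (this.trans_eq ?_)
    rw [hcardY]
  have hcover : (Set.univ : Set F) ⊆ {f : F | IsHard h w δ (functionsLaw f)} ∪ (S₁ ∪ S₂) := by
    intro f _
    by_contra hf
    simp only [Set.mem_union, not_or] at hf
    obtain ⟨hf0, hf1, hf2⟩ := hf
    have hinj : Function.Injective fun y i => f i y := not_not.1 hf1
    refine hf0 ⟨entropy_functionsLaw_of_injective f hinj, fun D t hD hP => ?_⟩
    by_contra hcon
    push Not at hcon
    refine hf2 (exists_trees_of_scheme f D (Nat.le_floor hcon.1.le) hD hP hBpos hcon.2 ?_)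
    intro l hl
    rw [Nat.le_div_iff_mul_le (by omega), mul_comm]
    exact Nat.le_floor (by exact_mod_cast hl)
  have hsum : Nat.card F ≤ {f : F | IsHard h w δ (functionsLaw f)}.ncard +
      (S₁.ncard + S₂.ncard) := by
    rw [← Set.ncard_univ]
    refine (Set.ncard_le_ncard hcover (Set.toFinite _)).trans ((Set.ncard_union_le _ _).trans ?_)
    exact Nat.add_le_add_left (Set.ncard_union_le _ _) _
  have hc₁' : (S₁.ncard : ℝ) * 2 ^ h ≤ Nat.card F := by exact_mod_cast hc₁
  have hc₂' : (S₂.ncard : ℝ) * 2 ^ h ≤ Nat.card F := by exact_mod_cast hc₂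
  have hsum' : (Nat.card F : ℝ) ≤ {f : F | IsHard h w δ (functionsLaw f)}.ncard +
      ((S₁.ncard : ℝ) + S₂.ncard) := by exact_mod_cast hsum
  have hbad : (S₁.ncard : ℝ) + S₂.ncard ≤ δ * Nat.card F := by
    have e1 : ((S₁.ncard : ℝ) + S₂.ncard) * 2 ^ h ≤ (δ * Nat.card F) * 2 ^ h := by
      have : 2 * (Nat.card F : ℝ) ≤ (δ * 2 ^ h) * Nat.card F := by gcongr
      linarith
    exact le_of_mul_le_mul_right e1 (by positivity)
  linarith

/-! ### Partial evaluation on a sample of the cells -/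

/-- The addresses probed by a cell-probe algorithm on a memory state. -/
def ProbeAlg.touched {w : ℕ} {A : Type*} (M : Memory w) : ProbeAlg w A → Finset ℕ
  | .answer _ => ∅
  | .probe addr next => insert addr ((next M[addr]?).touched M)

theorem ProbeAlg.card_touched_le {w : ℕ} {A : Type*} (M : Memory w) (P : ProbeAlg w A) :
    (P.touched M).card ≤ P.probes M := by
  induction P with
  | answer a => simp [touched, probes]
  | probe addr next ih =>
    exact (Finset.card_insert_le _ _).trans (Nat.add_le_add_right (ih _) 1)

/-- Run a cell-probe algorithm on a partially known memory, failing with `none` as soon as an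
unknown cell is probed. Here `z addr = some o` means that a probe of `addr` is known to return
`o`. -/
def ProbeAlg.evalOn {w : ℕ} {A : Type*} (z : ℕ → Option (Option (Cell w))) :
    ProbeAlg w A → Option A
  | .answer a => some a
  | .probe addr next => (z addr).bind fun o => (next o).evalOn z

theorem ProbeAlg.evalOn_eq {w : ℕ} {A : Type*} (z : ℕ → Option (Option (Cell w))) (M : Memory w)
    (P : ProbeAlg w A) (h : ∀ a ∈ P.touched M, z a = some M[a]?) :
    P.evalOn z = some (P.output M) := by
  induction P with
  | answer a => rfl
  | probe addr next ih =>
    simp only [touched, Finset.mem_insert, forall_eq_or_imp] at h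
    simp only [evalOn, output, h.1, Option.bind_some]
    exact ih _ h.2

/-- A sample of a memory of at most `m` cells: the set of `s` sampled addresses below `m`, and the
results of probing them. -/
abbrev Sample (m s w : ℕ) : Type :=
  Σ S : {S // S ∈ (Finset.range m).powersetCard s}, ({a // a ∈ S.1} → Option (Cell w))

/-- What is known about the memory from a sample: the sampled cells, and that addresses from `m` on
are blank. -/
def Sample.known {m s w : ℕ} (Z : Sample m s w) (a : ℕ) : Option (Option (Cell w)) :=
  if m ≤ a then some none else if h : a ∈ Z.1.1 then some (Z.2 ⟨a, h⟩) else none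

theorem card_sample (m s w : ℕ) :
    Fintype.card (Sample m s w) = m.choose s * (2 ^ w + 1) ^ s := by
  rw [Fintype.card_sigma]
  have : ∀ S : {S // S ∈ (Finset.range m).powersetCard s},
      Fintype.card ({a // a ∈ S.1} → Option (Cell w)) = (2 ^ w + 1) ^ s := by
    intro S
    have hS := (Finset.mem_powersetCard.1 S.2).2
    simp [Cell, hS]
  simp [this]

/-! ### Cell sampling -/

theorem choose_le_pow_mul_choose {K b : ℕ} (j m s : ℕ) (hb : 0 < b) (hs : b + j ≤ s)
    (hm : m ≤ K * b) : m.choose s ≤ K ^ j * (m - j).choose (s - j) := by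
  induction j generalizing m s with
  | zero => simp
  | succ j ih =>
    obtain ⟨s, rfl⟩ : ∃ s', s = s' + 1 := ⟨s - 1, by omega⟩
    cases m with
    | zero => simp
    | succ m =>
      have h1 := ih m s (by omega) (by omega)
      have h2 := Nat.add_one_mul_choose_eq m s
      have h3 : (m + 1).choose (s + 1) ≤ K * m.choose s := by
        refine Nat.le_of_mul_le_mul_right (c := s + 1) ?_ (by omega)
        rw [← h2]
        calc (m + 1) * m.choose s ≤ K * b * m.choose s := by gcongr
          _ ≤ K * (s + 1) * m.choose s := by
            gcongr
            omega
          _ = K * m.choose s * (s + 1) := by ring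
      calc (m + 1).choose (s + 1) ≤ K * m.choose s := h3
        _ ≤ K * (K ^ j * (m - j).choose (s - j)) := by gcongr
        _ = K ^ (j + 1) * (m + 1 - (j + 1)).choose (s + 1 - (j + 1)) := by
          rw [Nat.add_sub_add_right, Nat.add_sub_add_right]
          ring

theorem choose_sub_le_card_filter_superset {m s t : ℕ} (hts : t ≤ s) (hsm : s ≤ m) {q : Finset ℕ}
    (hq : q ⊆ Finset.range m) (hqt : q.card ≤ t) :
    (m - t).choose (s - t) ≤ (((Finset.range m).powersetCard s).filter (q ⊆ ·)).card := by
  obtain ⟨r, hqr, hr, hrt⟩ := Finset.exists_subsuperset_card_eq hq hqt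
    (by rw [Finset.card_range]; omega)
  have hc : (Finset.range m \ r).card = m - t := by
    rw [Finset.card_sdiff_of_subset hr, Finset.card_range, hrt]
  rw [← hc, ← Finset.card_powersetCard]
  refine Finset.card_le_card_of_injOn (fun u => u ∪ r) ?_ ?_
  · intro u hu
    have hu := Finset.mem_powersetCard.1 hu
    have hd : Disjoint u r := Finset.disjoint_of_subset_left hu.1 Finset.sdiff_disjoint
    simp only [Finset.coe_filter, Finset.mem_powersetCard, Set.mem_ofPred_eq]
    refine ⟨⟨Finset.union_subset (hu.1.trans Finset.sdiff_subset) hr, ?_⟩,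
      hqr.trans Finset.subset_union_right⟩
    rw [Finset.card_union_of_disjoint hd, hu.2, hrt]
    omega
  · intro u hu v hv huv
    have hu := Finset.mem_powersetCard.1 hu
    have hv := Finset.mem_powersetCard.1 hv
    have hdu : Disjoint u r := Finset.disjoint_of_subset_left hu.1 Finset.sdiff_disjoint
    have hdv : Disjoint v r := Finset.disjoint_of_subset_left hv.1 Finset.sdiff_disjoint
    have huv : u ∪ r = v ∪ r := huv
    rw [← Finset.union_sdiff_cancel_right hdu, huv, Finset.union_sdiff_cancel_right hdv]

/-- Cell sampling: some set of `s` cells contains the probes of an average share of the queries. -/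
theorem exists_sample_set {n m s t k : ℕ} (hts : t ≤ s) (hsm : s ≤ m) (q : Fin n → Finset ℕ)
    (hq : ∀ i, q i ⊆ Finset.range m) (hqt : ∀ i, (q i).card ≤ t)
    (hk : k * m.choose s ≤ n * (m - t).choose (s - t)) :
    ∃ S ∈ (Finset.range m).powersetCard s, k ≤ (Finset.univ.filter fun i => q i ⊆ S).card := by
  classical
  have hc : ((Finset.range m).powersetCard s).card = m.choose s := by
    rw [Finset.card_powersetCard, Finset.card_range]
  have hne : ((Finset.range m).powersetCard s).Nonempty := by
    rw [← Finset.card_pos, hc]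
    exact Nat.choose_pos hsm
  refine Finset.exists_le_of_sum_le hne ?_
  have h1 := Finset.sum_card_bipartiteAbove_eq_sum_card_bipartiteBelow (fun i S => q i ⊆ S)
    (s := (Finset.univ : Finset (Fin n))) (t := (Finset.range m).powersetCard s)
  simp only [Finset.bipartiteAbove, Finset.bipartiteBelow] at h1
  rw [← h1, Finset.sum_const, hc, smul_eq_mul, mul_comm]
  refine hk.trans ?_
  have h2 := Finset.card_nsmul_le_sum (Finset.univ : Finset (Fin n))
    (fun i => (((Finset.range m).powersetCard s).filter (q i ⊆ ·)).card) _
    (fun i _ => choose_sub_le_card_filter_superset hts hsm (hq i) (hqt i))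
  simpa using h2

/-! ### The union bound over all samples -/

theorem KWiseIndependent.mono {n : ℕ} {A : Type*} {μ : PMF (Fin n → A)} {k k' : ℕ} (h : k' ≤ k)
    (hμ : KWiseIndependent μ k) : KWiseIndependent μ k' :=
  fun S hS => hμ S (hS.trans h)

/-- Under `k`-wise independence with uniform marginals, a prediction of at least `k` files is correct
with probability at most `|A| ^ (-k)`. -/
theorem prob_prediction_le {n k : ℕ} {A : Type*} [Fintype A] [Nonempty A] {μ : PMF (Fin n → A)}
    (hU : UniformMarginals μ) (hI : KWiseIndependent μ k) (p : Fin n → Option A)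
    (hp : k ≤ Nat.card {i // p i ≠ none}) [DecidablePred fun x : Fin n → A =>
      ∀ i a, p i = some a → x i = a] :
    ∑ x, (μ x).toReal * (if ∀ i a, p i = some a → x i = a then 1 else 0) ≤
      ((Fintype.card A : ℝ) ^ k)⁻¹ := by
  classical
  rw [Nat.card_eq_fintype_card, Fintype.card_subtype] at hp
  obtain ⟨S, hS, hSk⟩ := Finset.exists_subset_card_eq hp
  have h1 := hI S hSk.le fun i => (p i).getD (Classical.arbitrary A)
  rw [Finset.prod_congr rfl fun i _ => by rw [hU i, PMF.uniformOfFintype_apply],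
    Finset.prod_const, hSk, PMF.toOuterMeasure_apply_fintype] at h1
  have h2 := congrArg ENNReal.toReal h1
  rw [ENNReal.toReal_sum] at h2
  · rw [ENNReal.toReal_pow, ENNReal.toReal_inv, ENNReal.toReal_natCast, inv_pow] at h2
    rw [← h2]
    refine Finset.sum_le_sum fun x _ => ?_
    split_ifs with hx
    · rw [Set.indicator_of_mem, mul_one]
      intro i hi
      obtain ⟨a, ha⟩ := Option.ne_none_iff_exists'.1 (Finset.mem_filter.1 (hS hi)).2
      rw [hx i a ha, ha]
      rfl
    · rw [mul_zero]
      exact ENNReal.toReal_nonneg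
  · intro x _
    by_cases hx : x ∈ {x : Fin n → A | ∀ i ∈ S, x i = (p i).getD (Classical.arbitrary A)}
    · rw [Set.indicator_of_mem hx]
      exact μ.apply_ne_top x
    · rw [Set.indicator_of_notMem hx]
      simp

/-- If samples of `s` out of `m` cells answer `k` queries on average, then there are at least
`|A| ^ k / 2` samples: for half of the inputs some sample predicts `k` files correctly. -/
theorem card_pow_le_two_mul_card_sample {n k m s t w : ℕ} {A : Type*} [Fintype A] [Nonempty A]
    {μ : PMF (Fin n → A)} (D : Scheme n A w) (hU : UniformMarginals μ)
    (hI : KWiseIndependent μ k) (hD : D.Solves μ) (hP : D.DecodesWithin μ t) (hts : t ≤ s)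
    (hsm : s ≤ m) (hk : k * m.choose s ≤ n * (m - t).choose (s - t)) {B : ℝ} (hB : 0 < B)
    (hE : D.expectedBits μ ≤ B) (hm : ∀ l : ℕ, (w : ℝ) * l ≤ 2 * B → l ≤ m) :
    (Fintype.card A : ℝ) ^ k ≤ 2 * (m.choose s * (2 ^ w + 1) ^ s) := by
  classical
  have h1 := half_le_prob_short D μ hB hE
  let good : Finset (Sample m s w) := Finset.univ.filter fun Z =>
    k ≤ Nat.card {i // (D.dec i).evalOn Z.known ≠ none}
  have h2 : ∑ x, (μ x).toReal * (if (w : ℝ) * ((D.enc x).length : ℝ) ≤ 2 * B then 1 else 0) ≤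
      ∑ Z ∈ good, ∑ x, (μ x).toReal *
        (if ∀ i a, (D.dec i).evalOn Z.known = some a → x i = a then 1 else 0) := by
    rw [Finset.sum_comm]
    refine Finset.sum_le_sum fun x _ => ?_
    rw [← Finset.mul_sum]
    by_cases hx : μ x = 0
    · simp [hx]
    have hxs : x ∈ μ.support := (PMF.mem_support_iff _ _).2 hx
    refine mul_le_mul_of_nonneg_left ?_ ENNReal.toReal_nonneg
    have hnn : ∀ Z ∈ good, (0 : ℝ) ≤
        if ∀ i a, (D.dec i).evalOn Z.known = some a → x i = a then 1 else 0 := by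
      intro Z _
      split_ifs <;> norm_num
    split_ifs with hl
    swap
    · exact Finset.sum_nonneg hnn
    have hlen := hm _ hl
    obtain ⟨S, hS, hkS⟩ := exists_sample_set hts hsm
      (fun i => ((D.dec i).touched (D.enc x)).filter (· < m))
      (fun i a ha => Finset.mem_range.2 (Finset.mem_filter.1 ha).2)
      (fun i => (Finset.card_filter_le _ _).trans
        ((ProbeAlg.card_touched_le _ _).trans (hP x hxs i))) hk
    let Z : Sample m s w := ⟨⟨S, hS⟩, fun a => (D.enc x)[a.1]?⟩
    have hknown : ∀ a o, Z.known a = some o → o = (D.enc x)[a]? := by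
      intro a o ho
      simp only [Sample.known] at ho
      split_ifs at ho with h3 h4
      · rw [List.getElem?_eq_none (hlen.trans h3)]
        exact (Option.some.inj ho).symm
      · exact (Option.some.inj ho).symm
    have hsound : ∀ (P : ProbeAlg w A) a, P.evalOn Z.known = some a → a = P.output (D.enc x) := by
      intro P
      induction P with
      | answer b => exact fun a h => (Option.some.inj h).symm
      | probe addr next ih =>
        intro a h
        simp only [ProbeAlg.evalOn, Option.bind_eq_some_iff] at h
        obtain ⟨o, ho, h⟩ := h
        rw [ProbeAlg.output, ← hknown _ _ ho]
        exact ih o a h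
    have hgood : Z ∈ good := by
      refine Finset.mem_filter.2 ⟨Finset.mem_univ _, hkS.trans ?_⟩
      rw [Nat.card_eq_fintype_card, Fintype.card_subtype]
      refine Finset.card_le_card fun i hi => ?_
      have hi := (Finset.mem_filter.1 hi).2
      refine Finset.mem_filter.2 ⟨Finset.mem_univ _, ?_⟩
      rw [ProbeAlg.evalOn_eq Z.known (D.enc x)]
      · simp
      · intro a ha
        by_cases ham : m ≤ a
        · rw [List.getElem?_eq_none (hlen.trans ham)]
          simp [Sample.known, ham]
        · have haS : a ∈ S := hi (Finset.mem_filter.2 ⟨ha, by omega⟩)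
          simp [Sample.known, ham, Z, haS]
    refine le_trans ?_ (Finset.single_le_sum hnn hgood)
    rw [if_pos]
    intro i a ha
    rw [hsound _ _ ha, hD x hxs i]
  have h3 : ∑ Z ∈ good, ∑ x, (μ x).toReal *
      (if ∀ i a, (D.dec i).evalOn Z.known = some a → x i = a then 1 else 0) ≤
      good.card • ((Fintype.card A : ℝ) ^ k)⁻¹ :=
    Finset.sum_le_card_nsmul _ _ _ fun Z hZ =>
      prob_prediction_le hU hI _ (Finset.mem_filter.1 hZ).2
  have h4 : (good.card : ℝ) ≤ m.choose s * (2 ^ w + 1) ^ s := by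
    have := Finset.card_le_univ good
    rw [card_sample] at this
    exact_mod_cast this
  have hpos : (0 : ℝ) < (Fintype.card A : ℝ) ^ k := by
    have : 0 < Fintype.card A := Fintype.card_pos
    positivity
  have h5 := h1.trans (h2.trans h3)
  rw [nsmul_eq_mul, ← div_eq_mul_inv, le_div_iff₀ hpos] at h5
  linarith

/-! ### The logarithmic lower bound -/

theorem choose_le_pow_mul_one_add_pow (m s : ℕ) {r : ℝ} (hr : 0 < r) :
    (m.choose s : ℝ) ≤ r ^ s * (1 + r⁻¹) ^ m := by
  rcases lt_or_ge m s with h | h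
  · rw [Nat.choose_eq_zero_of_lt h]
    simp only [Nat.cast_zero]
    positivity
  have h1 : (m.choose s : ℝ) * r⁻¹ ^ s ≤ (1 + r⁻¹) ^ m := by
    rw [add_comm, add_pow]
    refine le_trans (le_of_eq ?_) (Finset.single_le_sum (f := fun j =>
      r⁻¹ ^ j * 1 ^ (m - j) * (m.choose j : ℝ)) (fun j _ => by positivity)
      (Finset.mem_range.2 (Nat.lt_succ_of_le h)))
    simp [mul_comm]
  rwa [inv_pow, ← div_eq_mul_inv, div_le_iff₀' (by positivity)] at h1

/-- A sample of an `r`-th part of the cells, with its addresses, takes only an `O(log r / r)` fraction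
of the bits of the memory. -/
theorem logb_card_sample_le {m r w : ℕ} (hr : 1 ≤ r) (hw : 1 ≤ w) :
    Real.logb 2 (2 * ((m.choose (m / r) : ℝ) * (2 ^ w + 1) ^ (m / r))) ≤
      1 + m * w / r * (Real.logb 2 r + 4) := by
  have hr0 : (0 : ℝ) < r := by exact_mod_cast hr
  have hw1 : (1 : ℝ) ≤ w := by exact_mod_cast hw
  set s := m / r with hs
  have hsm : (s : ℝ) ≤ m / r := Nat.cast_div_le
  have hc : (0 : ℝ) < m.choose s := by exact_mod_cast Nat.choose_pos (Nat.div_le_self m r)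
  have hQ : (2 : ℝ) ^ w + 1 ≤ 2 ^ (2 * w) := by
    have : (2 : ℝ) ≤ 2 ^ w := by
      calc (2 : ℝ) = 2 ^ 1 := by norm_num
        _ ≤ 2 ^ w := pow_le_pow_right₀ (by norm_num) hw
    rw [two_mul, pow_add]
    nlinarith
  have hle : 2 * ((m.choose s : ℝ) * (2 ^ w + 1) ^ s) ≤
      2 * ((r : ℝ) ^ s * (1 + (r : ℝ)⁻¹) ^ m * (2 ^ (2 * w)) ^ s) := by
    gcongr
    exact choose_le_pow_mul_one_add_pow m s hr0
  have hlog : Real.logb 2 (1 + (r : ℝ)⁻¹) ≤ 2 / r := by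
    rw [Real.logb, div_le_iff₀ (Real.log_pos one_lt_two)]
    have h1 : Real.log (1 + (r : ℝ)⁻¹) ≤ (r : ℝ)⁻¹ := by
      have := Real.log_le_sub_one_of_pos (x := 1 + (r : ℝ)⁻¹) (by positivity)
      linarith
    have h2 : (r : ℝ)⁻¹ ≤ 2 / r * Real.log 2 := by
      rw [div_mul_eq_mul_div, inv_eq_one_div]
      gcongr
      linarith [Real.log_two_gt_d9]
    linarith
  have hlr : 0 ≤ Real.logb 2 r := Real.logb_nonneg one_lt_two (by exact_mod_cast hr)
  refine (Real.logb_le_logb_of_le one_lt_two (by positivity) hle).trans ?_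
  rw [Real.logb_mul (by norm_num) (by positivity), Real.logb_mul (by positivity) (by positivity),
    Real.logb_mul (by positivity) (by positivity), Real.logb_pow, Real.logb_pow, Real.logb_pow,
    Real.logb_pow, Real.logb_self_eq_one one_lt_two]
  push_cast
  have e1 : (s : ℝ) * Real.logb 2 r ≤ m * w / r * Real.logb 2 r := by
    gcongr
    refine hsm.trans ?_
    gcongr
    nlinarith [(Nat.cast_nonneg m : (0 : ℝ) ≤ m)]
  have e2 : (m : ℝ) * Real.logb 2 (1 + (r : ℝ)⁻¹) ≤ m * w / r * 2 := by
    calc (m : ℝ) * Real.logb 2 (1 + (r : ℝ)⁻¹) ≤ m * (2 / r) := by gcongr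
      _ = m * 1 / r * 2 := by ring
      _ ≤ m * w / r * 2 := by gcongr
  have e3 : (s : ℝ) * (2 * w * 1) ≤ m * w / r * 2 := by
    calc (s : ℝ) * (2 * w * 1) ≤ m / r * (2 * w * 1) := by gcongr
      _ = m * w / r * 2 := by ring
  linarith

open Filter Topology in
theorem exists_sampling_rate {C : ℝ} (hC : 0 < C) :
    ∃ r : ℕ, 1 ≤ r ∧ 2 * C / r * (Real.logb 2 r + 4) ≤ 1 / (2 * C) := by
  have h1 : Tendsto (fun r : ℕ => Real.log r / (r : ℝ)) atTop (𝓝 0) :=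
    (Real.isLittleO_log_id_atTop.tendsto_div_nhds_zero).comp tendsto_natCast_atTop_atTop
  have h2 : Tendsto (fun r : ℕ => (r : ℝ)⁻¹) atTop (𝓝 0) := tendsto_inv_atTop_nhds_zero_nat
  have h3 : Tendsto (fun r : ℕ => 2 * C * (Real.log r / (r : ℝ) / Real.log 2 + 4 * (r : ℝ)⁻¹))
      atTop (𝓝 (2 * C * (0 / Real.log 2 + 4 * 0))) :=
    ((h1.div_const _).add (h2.const_mul _)).const_mul _
  rw [zero_div, mul_zero, add_zero, mul_zero] at h3
  obtain ⟨r, hr, hr1⟩ := ((h3.eventually_le_const (show (0 : ℝ) < 1 / (2 * C) by positivity)).and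
    (eventually_ge_atTop 1)).exists
  refine ⟨r, hr1, le_trans (le_of_eq ?_) hr⟩
  rw [Real.logb]
  ring

open Filter Topology in
theorem eventually_entropy_large {C ε : ℝ} (hC : 0 < C) (hε : 0 < ε) (r : ℕ) (hr : 1 ≤ r) :
    ∀ᶠ H : ℝ in atTop, 2 * C < H ∧ H / C + 1 ≤ H ^ (1 + ε / 2) ∧
      2 * r * (1 + Real.logb 2 H) + 1 ≤ 2 * C * H ^ (ε / (1 + ε)) := by
  have hr0 : (0 : ℝ) < r := by exact_mod_cast hr
  have hη : 0 < ε / (1 + ε) := by positivity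
  have h1 : ∀ᶠ H : ℝ in atTop, 1 / C + 1 ≤ H ^ (ε / 2) :=
    (tendsto_rpow_atTop (half_pos hε)).eventually_ge_atTop _
  have h2 : ∀ᶠ H : ℝ in atTop, (2 * r + 1) / C ≤ H ^ (ε / (1 + ε)) :=
    (tendsto_rpow_atTop hη).eventually_ge_atTop _
  have h3 : ∀ᶠ H : ℝ in atTop, ‖Real.log H‖ ≤ C / (4 * r) * ‖H ^ (ε / (1 + ε))‖ :=
    (isLittleO_log_rpow_atTop hη).bound (by positivity)
  filter_upwards [h1, h2, h3, eventually_gt_atTop (2 * C), eventually_ge_atTop 1] with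
    H h1 h2 h3 h4 h5
  have hH : 0 < H := by linarith
  refine ⟨h4, ?_, ?_⟩
  · rw [Real.rpow_add hH, Real.rpow_one]
    calc H / C + 1 ≤ H / C + H := by linarith
      _ = H * (1 / C + 1) := by ring
      _ ≤ H * H ^ (ε / 2) := by gcongr
  · have hl : 0 ≤ Real.log H := Real.log_nonneg h5
    rw [Real.norm_of_nonneg hl, Real.norm_of_nonneg (by positivity)] at h3
    have e1 : Real.logb 2 H ≤ 2 * Real.log H := by
      rw [Real.logb, div_le_iff₀ (Real.log_pos one_lt_two)]
      nlinarith [Real.log_two_gt_d9]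
    rw [div_le_iff₀ hC] at h2
    have e2 : 4 * r * Real.log H ≤ C * H ^ (ε / (1 + ε)) := by
      calc 4 * r * Real.log H ≤ 4 * r * (C / (4 * r) * H ^ (ε / (1 + ε))) := by gcongr
        _ = C * H ^ (ε / (1 + ε)) := by field_simp
    have e3 : 2 * r * Real.logb 2 H ≤ 2 * r * (2 * Real.log H) := by gcongr
    linarith

/-- A file that is not constant cannot be decoded without probes. -/
theorem Scheme.DecodesWithin.pos {n t w : ℕ} {A : Type*} [Fintype A] [Nontrivial A]
    {μ : PMF (Fin n → A)} {D : Scheme n A w} (hP : D.DecodesWithin μ t) (hD : D.Solves μ)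
    (hU : UniformMarginals μ) (i : Fin n) : 1 ≤ t := by
  rw [Nat.one_le_iff_ne_zero]
  rintro rfl
  have key : ∃ b, ∀ x ∈ μ.support, x i = b := by
    cases hd : D.dec i with
    | answer b =>
      refine ⟨b, fun x hx => ?_⟩
      rw [← hD x hx i, hd]
      rfl
    | probe addr next =>
      obtain ⟨x, hx⟩ := μ.support_nonempty
      have := hP x hx i
      rw [hd] at this
      simp [ProbeAlg.probes] at this
  obtain ⟨b, hb⟩ := key
  obtain ⟨a, ha⟩ := exists_ne b
  have : a ∈ (μ.map fun x => x i).support := by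
    rw [hU i]
    exact PMF.mem_support_uniformOfFintype a
  obtain ⟨x, hx, hxa⟩ := (PMF.mem_support_map_iff _ _ _).1 this
  exact ha (hxa.symm.trans (hb x hx))

/-- For large entropy `H`, fewer than `c log H` probes are not enough: sampling an `r`-th of the
cells would leave `k` files decodable from too few bits. -/
theorem not_decodesWithin_of_large {C ε H c : ℝ} {n k w t r : ℕ} {A : Type*} [Fintype A]
    [Nontrivial A] {μ : PMF (Fin n → A)} (D : Scheme n A w) (hC : 0 < C) (hε : 0 < ε)
    (hr : 1 ≤ r) (hrC : 2 * C / r * (Real.logb 2 r + 4) ≤ 1 / (2 * C)) (hw : 1 ≤ w)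
    (hU : UniformMarginals μ) (hI : KWiseIndependent μ k)
    (hk : H ≤ C * (k * Real.logb 2 (Fintype.card A))) (hwH : (w : ℝ) ^ (1 + ε) ≤ H)
    (hHn : H ^ (1 + ε) ≤ n) (hD : D.Solves μ) (hP : D.DecodesWithin μ t)
    (hE : D.expectedBits μ ≤ C * H) (hH1 : 1 ≤ H) (hH2 : 2 * C < H)
    (hH3 : H / C + 1 ≤ H ^ (1 + ε / 2))
    (hH4 : 2 * r * (1 + Real.logb 2 H) + 1 ≤ 2 * C * H ^ (ε / (1 + ε)))
    (hc1 : c ≤ 1) (hc2 : c * Real.logb 2 (2 * r) ≤ ε / 2) : c * Real.logb 2 H ≤ t := by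
  by_contra ht
  push Not at ht
  have hH0 : 0 < H := by linarith
  have hr0 : (0 : ℝ) < r := by exact_mod_cast hr
  have hr1 : (1 : ℝ) ≤ r := by exact_mod_cast hr
  have hw0 : (0 : ℝ) < w := by exact_mod_cast hw
  have hlH : 0 ≤ Real.logb 2 H := Real.logb_nonneg one_lt_two hH1
  have htH : (t : ℝ) ≤ Real.logb 2 H := by nlinarith
  have hA : 2 ≤ Fintype.card A := Fintype.one_lt_card
  set a := Fintype.card A
  have ha2 : (2 : ℝ) ≤ a := by exact_mod_cast hA
  have hla : 1 ≤ Real.logb 2 a := by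
    rw [Real.le_logb_iff_rpow_le one_lt_two (by linarith), Real.rpow_one]
    exact ha2
  -- `k'` files already carry `H / C` bits.
  set k' := ⌈H / (C * Real.logb 2 a)⌉₊ with hk'
  have hk'k : k' ≤ k := by
    rw [hk', Nat.ceil_le, div_le_iff₀ (by positivity)]
    linarith
  have hk'1 : H / C ≤ k' * Real.logb 2 a := by
    have : H / (C * Real.logb 2 a) ≤ k' := Nat.le_ceil _
    rw [div_le_iff₀ (by positivity)] at this ⊢
    linarith
  have hk'2 : (k' : ℝ) ≤ H / C + 1 := by
    have : (k' : ℝ) < H / (C * Real.logb 2 a) + 1 := Nat.ceil_lt_add_one (by positivity)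
    have h2 : H / (C * Real.logb 2 a) ≤ H / C :=
      div_le_div_of_nonneg_left hH0.le hC (le_mul_of_one_le_right hC.le hla)
    linarith
  set m := ⌊2 * (C * H) / w⌋₊ with hm
  have hm1 : (m : ℝ) * w ≤ 2 * (C * H) := by
    have : (m : ℝ) ≤ 2 * (C * H) / w := Nat.floor_le (by positivity)
    rwa [le_div_iff₀ hw0] at this
  have hm2 : 2 * r * (1 + Real.logb 2 H) ≤ m := by
    have e1 : (w : ℝ) ≤ H ^ (1 / (1 + ε)) := by
      calc (w : ℝ) = ((w : ℝ) ^ (1 + ε)) ^ (1 / (1 + ε)) := by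
            rw [← Real.rpow_mul hw0.le, mul_one_div_cancel (by positivity), Real.rpow_one]
        _ ≤ H ^ (1 / (1 + ε)) := by gcongr
    have e2 : H ^ (ε / (1 + ε)) * w ≤ H := by
      calc H ^ (ε / (1 + ε)) * w ≤ H ^ (ε / (1 + ε)) * H ^ (1 / (1 + ε)) := by gcongr
        _ = H := by
          rw [← Real.rpow_add hH0, ← add_div, add_comm ε, div_self (by positivity), Real.rpow_one]
    have e3 : 2 * C * H ^ (ε / (1 + ε)) ≤ 2 * (C * H) / w := by
      rw [le_div_iff₀ hw0]
      nlinarith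
    have e4 : 2 * (C * H) / w < m + 1 := Nat.lt_floor_add_one _
    linarith
  set s := m / r with hs
  have hs1 : (m : ℝ) / r < s + 1 := by
    rw [div_lt_iff₀ hr0]
    have := Nat.lt_div_mul_add (a := m) (show 0 < r by omega)
    rw [← hs] at this
    have h2 : (m : ℝ) < s * r + r := by exact_mod_cast this
    linarith
  have hst : (m : ℝ) ≤ 2 * r * (s - t) := by
    have e1 : (m : ℝ) < r * (s + 1) := by
      rw [div_lt_iff₀ hr0] at hs1
      linarith
    have e2 : (r : ℝ) * t ≤ r * Real.logb 2 H := by gcongr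
    linarith
  have hts : t < s := by
    have : (0 : ℝ) < 2 * r * (s - t) := lt_of_lt_of_le (by positivity) (hm2.trans hst)
    have : (0 : ℝ) < s - t := pos_of_mul_pos_right this (by positivity)
    have : (t : ℝ) < s := by linarith
    exact_mod_cast this
  have hst' : m ≤ (2 * r) * (s - t) := by
    have : (m : ℝ) ≤ ((2 * r * (s - t) : ℕ) : ℝ) := by
      rw [Nat.cast_mul, Nat.cast_sub hts.le]
      push_cast
      exact hst
    exact_mod_cast this
  -- A sample contains the probes of a `(2 * r) ^ (-t)` fraction of the queries.
  have hkn : k' * (2 * r) ^ t ≤ n := by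
    have e1 : ((2 : ℝ) * r) ^ t ≤ H ^ (ε / 2) := by
      rw [← Real.logb_le_logb one_lt_two (by positivity) (by positivity), Real.logb_pow,
        Real.logb_rpow_eq_mul_logb_of_pos hH0]
      have hl2 : 0 ≤ Real.logb 2 (2 * r) := Real.logb_nonneg one_lt_two (by linarith)
      calc (t : ℝ) * Real.logb 2 (2 * r) ≤ (c * Real.logb 2 H) * Real.logb 2 (2 * r) := by gcongr
        _ = (c * Real.logb 2 (2 * r)) * Real.logb 2 H := by ring
        _ ≤ ε / 2 * Real.logb 2 H := by gcongr
    have e2 : (k' : ℝ) * (2 * r) ^ t ≤ n := by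
      calc (k' : ℝ) * (2 * r) ^ t ≤ H ^ (1 + ε / 2) * H ^ (ε / 2) := by
            gcongr
            exact hk'2.trans hH3
        _ = H ^ (1 + ε) := by
          rw [← Real.rpow_add hH0]
          congr 1
          ring
        _ ≤ n := hHn
    exact_mod_cast e2
  have hcount : k' * m.choose s ≤ n * (m - t).choose (s - t) := by
    calc k' * m.choose s ≤ k' * ((2 * r) ^ t * (m - t).choose (s - t)) := by
          gcongr
          exact choose_le_pow_mul_choose t m s (Nat.sub_pos_of_lt hts) (by omega) hst'
      _ = k' * (2 * r) ^ t * (m - t).choose (s - t) := by ring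
      _ ≤ n * (m - t).choose (s - t) := by gcongr
  have hfin := card_pow_le_two_mul_card_sample D hU (hI.mono hk'k) hD hP hts.le
    (Nat.div_le_self m r) hcount (show 0 < C * H by positivity) hE (fun l hl => by
      refine Nat.le_floor ?_
      rw [le_div_iff₀ hw0]
      linarith)
  have hlog := (Real.logb_le_logb_of_le one_lt_two (by positivity) hfin).trans
    (logb_card_sample_le hr hw)
  rw [Real.logb_pow] at hlog
  have hlr : 0 ≤ Real.logb 2 r := Real.logb_nonneg one_lt_two hr1
  have e1 : (m : ℝ) * w / r * (Real.logb 2 r + 4) ≤ H / (2 * C) := by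
    calc (m : ℝ) * w / r * (Real.logb 2 r + 4)
        ≤ 2 * (C * H) / r * (Real.logb 2 r + 4) := by gcongr
      _ = H * (2 * C / r * (Real.logb 2 r + 4)) := by ring
      _ ≤ H * (1 / (2 * C)) := by gcongr
      _ = H / (2 * C) := by ring
  have e2 : H / C = H / (2 * C) + H / (2 * C) := by
    field_simp
    ring
  have e3 : 1 < H / (2 * C) := by
    rw [lt_div_iff₀ (by positivity)]
    linarith
  linarith

/-- Schemes for distributions with independence proportional to their entropy need a logarithmic
number of probes. -/
theorem exists_logarithmic_bound {C ε : ℝ} (hC : 0 < C) (hε : 0 < ε) : ∃ c : ℝ, 0 < c ∧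
      ∀ (n k w t : ℕ) (A : Type) [Fintype A] [Nonempty A] (μ : PMF (Fin n → A))
        (D : Scheme n A w),
        1 ≤ w →
        UniformMarginals μ →
        KWiseIndependent μ k →
        entropy μ ≤ C * (k * Real.logb 2 (Fintype.card A)) →
        (w : ℝ) ^ (1 + ε) ≤ entropy μ →
        entropy μ ^ (1 + ε) ≤ n →
        D.Solves μ →
        D.DecodesWithin μ t →
        D.expectedBits μ ≤ C * entropy μ →
        c * Real.logb 2 (entropy μ) ≤ t ∧
          ((n : ℝ) ^ ε ≤ entropy μ → c * Real.logb 2 n ≤ t) := by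
  obtain ⟨r, hr, hrC⟩ := exists_sampling_rate hC
  obtain ⟨H₀, hH₀⟩ := Filter.eventually_atTop.1 (eventually_entropy_large hC hε r hr)
  have hr1 : (1 : ℝ) ≤ r := by exact_mod_cast hr
  have hl2 : 0 < Real.logb 2 (2 * r) := Real.logb_pos one_lt_two (by linarith)
  -- The last term makes the bound trivial for entropies below `H₀`, where `t ≥ 1` is enough.
  set c₁ := min 1 (min (ε / 2 / Real.logb 2 (2 * r)) (1 / (|Real.logb 2 H₀| + 1))) with hc₁
  have hc₁0 : 0 < c₁ := by
    refine lt_min one_pos (lt_min (by positivity) (by positivity))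
  have hc₁1 : c₁ ≤ 1 := min_le_left _ _
  have hc₁2 : c₁ * Real.logb 2 (2 * r) ≤ ε / 2 := by
    rw [← le_div_iff₀ hl2]
    exact (min_le_right _ _).trans (min_le_left _ _)
  have hc₁3 : c₁ * (|Real.logb 2 H₀| + 1) ≤ 1 := by
    rw [← le_div_iff₀ (by positivity)]
    exact (min_le_right _ _).trans (min_le_right _ _)
  refine ⟨c₁ * min 1 ε, mul_pos hc₁0 (lt_min one_pos hε), ?_⟩
  intro n k w t A _ _ μ D hw hU hI hk hwH hHn hD hP hE
  set H := entropy μ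
  have hw1 : (1 : ℝ) ≤ w := by exact_mod_cast hw
  have hH1 : 1 ≤ H := (Real.one_le_rpow hw1 (by positivity)).trans hwH
  have hH0 : 0 < H := by linarith
  have hn1 : (1 : ℝ) ≤ n := (Real.one_le_rpow hH1 (by positivity)).trans hHn
  have hA : Nontrivial A := by
    by_contra hA
    rw [not_nontrivial_iff_subsingleton] at hA
    have : Fintype.card A = 1 :=
      le_antisymm (Fintype.card_le_one_iff_subsingleton.2 hA) Fintype.card_pos
    rw [this] at hk
    simp at hk
    linarith
  have hlH : 0 ≤ Real.logb 2 H := Real.logb_nonneg one_lt_two hH1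
  have hmain : c₁ * Real.logb 2 H ≤ t := by
    rcases le_or_gt H₀ H with hle | hlt
    · obtain ⟨q1, q2, q3⟩ := hH₀ H hle
      exact not_decodesWithin_of_large D hC hε hr hrC hw hU hI hk hwH hHn hD hP hE hH1 q1 q2 q3
        hc₁1 hc₁2
    · have ht : (1 : ℝ) ≤ t := by
        exact_mod_cast hP.pos hD hU ⟨0, by exact_mod_cast hn1⟩
      have e1 : Real.logb 2 H ≤ |Real.logb 2 H₀| + 1 := by
        have := Real.logb_le_logb_of_le one_lt_two hH0 hlt.le
        linarith [le_abs_self (Real.logb 2 H₀)]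
      calc c₁ * Real.logb 2 H ≤ c₁ * (|Real.logb 2 H₀| + 1) := by gcongr
        _ ≤ t := hc₁3.trans ht
  constructor
  · calc c₁ * min 1 ε * Real.logb 2 H ≤ c₁ * 1 * Real.logb 2 H := by
          gcongr
          exact min_le_left _ _
      _ ≤ t := by rwa [mul_one]
  · intro hnH
    have hln : 0 ≤ Real.logb 2 n := Real.logb_nonneg one_lt_two hn1
    have e1 : ε * Real.logb 2 n ≤ Real.logb 2 H := by
      rw [← Real.logb_rpow_eq_mul_logb_of_pos (by linarith)]
      exact Real.logb_le_logb_of_le one_lt_two (by positivity) hnH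
    calc c₁ * min 1 ε * Real.logb 2 n ≤ c₁ * ε * Real.logb 2 n := by
          gcongr
          exact min_le_right _ _
      _ = c₁ * (ε * Real.logb 2 n) := by ring
      _ ≤ c₁ * Real.logb 2 H := by gcongr
      _ ≤ t := hmain

end LDSC

theorem mainTheorem9 :
    -- distributions with independence proportional to their entropy
    (∀ C ε : ℝ, 0 < C → 0 < ε → ∃ c : ℝ, 0 < c ∧
      ∀ (n k w t : ℕ) (A : Type) [Fintype A] [Nonempty A] (μ : PMF (Fin n → A))
        (D : LDSC.Scheme n A w),
        1 ≤ w →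
        LDSC.UniformMarginals μ →
        LDSC.KWiseIndependent μ k →
        LDSC.entropy μ ≤ C * (k * Real.logb 2 (Fintype.card A)) →
        (w : ℝ) ^ (1 + ε) ≤ LDSC.entropy μ →
        LDSC.entropy μ ^ (1 + ε) ≤ n →
        D.Solves μ →
        D.DecodesWithin μ t →
        D.expectedBits μ ≤ C * LDSC.entropy μ →
        c * Real.logb 2 (LDSC.entropy μ) ≤ t ∧
          ((n : ℝ) ^ ε ≤ LDSC.entropy μ → c * Real.logb 2 n ≤ t)) ∧
    -- most distributions given by `n` functions of a random `h`-bit string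
    (∀ δ : ℝ, 0 < δ → ∃ h₀ : ℕ,
      ∀ (n h w : ℕ) (A : Type) [Fintype A] [Nontrivial A],
        h₀ ≤ h → 4 * h ≤ n → Real.logb 2 n ≤ (h : ℝ) ^ (δ / 2) →
        1 ≤ w → (w : ℝ) ≤ (h : ℝ) ^ (δ / 2) →
        (1 - δ) * (Nat.card (Fin n → (Fin h → Bool) → A) : ℝ) ≤
          ({f : Fin n → (Fin h → Bool) → A |
            LDSC.IsHard h w δ (LDSC.functionsLaw f)}.ncard : ℝ)) ∧
    -- tightness: all these distributions can be compressed optimally with `⌈h / w⌉` probes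
    (∀ (n h w : ℕ) (A : Type) [Fintype A] (f : Fin n → (Fin h → Bool) → A), 1 ≤ w →
      ∃ D : LDSC.Scheme n A w, D.Solves (LDSC.functionsLaw f) ∧
        D.DecodesWithin (LDSC.functionsLaw f) ⌈(h : ℝ) / w⌉₊ ∧
        D.expectedBits (LDSC.functionsLaw f) ≤ (h : ℝ) + w) := by
  exact ⟨fun C ε hC hε => LDSC.exists_logarithmic_bound hC hε,
    fun δ hδ => LDSC.exists_hard_threshold hδ,
    fun n h w A _ f hw => LDSC.exists_tight_scheme n h w A f hw⟩
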